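/- For a set $\Omega$ and a subgroup $H\le \mathrm{Sym}(\Omega)$, the $2$-closure of $H$ on $\Omega$ is \[H^{(2),\Omega}=\{\theta\in\mathrm{Sym}(\Omega)\mid \forall \alpha,\beta\in\Omega\ \exists g\in H:\ \alpha^\theta=\alpha^g,\ \beta^\theta=\beta^g\}.\] A group $G$ is called a $2$-closed group if $H=H^{(2),\Omega}$ for every set $\Omega$ and every subgroup $H\le\mathrm{Sym}(\Omega)$ with $H\cong G$. For $n\ge 3$, the generalized quaternion group of order $2^n$ is \[Q_{2^n}=\langle a,x\mid a^{2^{n-1}}=1,\ x^2=a^{2^{n-2}},\ x^{-1}ax=a^{-1}\rangle.\] Let $G$ be a finite $2$-group. Then $G$ is a $2$-closed group if and only if $G$ is cyclic or $G\cong Q_{2^n}$ for some $n\ge 3$. -/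

import Mathlib

/-- The 2-closure of a permutation group `H` on `Ω`: all permutations `θ` of `Ω` such that on every
pair of points `θ` agrees with some element of `H`. -/
def twoClosure {Ω : Type*} (H : Subgroup (Equiv.Perm Ω)) : Subgroup (Equiv.Perm Ω) where
  carrier := {θ | ∀ α β : Ω, ∃ g ∈ H, θ α = g α ∧ θ β = g β}
  one_mem' := fun _ _ => ⟨1, H.one_mem, rfl, rfl⟩
  mul_mem' := by
    intro θ φ hθ hφ α β
    obtain ⟨h, hh, h₁, h₂⟩ := hφ α β
    obtain ⟨g, hg, g₁, g₂⟩ := hθ (φ α) (φ β)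
    refine ⟨g * h, H.mul_mem hg hh, ?_, ?_⟩
    · rw [Equiv.Perm.mul_apply, Equiv.Perm.mul_apply, g₁, h₁]
    · rw [Equiv.Perm.mul_apply, Equiv.Perm.mul_apply, g₂, h₂]
  inv_mem' := by
    intro θ hθ α β
    obtain ⟨g, hg, g₁, g₂⟩ := hθ (θ⁻¹ α) (θ⁻¹ β)
    have e : ∀ γ, θ (θ⁻¹ γ) = γ := fun γ => θ.apply_symm_apply γ
    rw [e] at g₁ g₂
    exact ⟨g⁻¹, H.inv_mem hg, (g.symm_apply_eq.mpr g₁).symm, (g.symm_apply_eq.mpr g₂).symm⟩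

universe u w

/-- An abstract group `G` is a 2-closed group if every permutation group isomorphic to `G`, on any
set `Ω`, equals its own 2-closure. The universe `w` of the sets `Ω` is arbitrary. -/
def IsTwoClosedGroup (G : Type u) [Group G] : Prop :=
  ∀ (Ω : Type w) (H : Subgroup (Equiv.Perm Ω)), Nonempty (G ≃* H) → H = twoClosure H

/-- `G` is a generalized quaternion group `Q_{2^n}` of order `2^n`, for some `n ≥ 3`.
(`QuaternionGroup m` has order `4 * m`.) -/
def IsGeneralizedQuaternion (G : Type u) [Group G] : Prop :=
  ∃ n : ℕ, 3 ≤ n ∧ Nonempty (G ≃* QuaternionGroup (2 ^ (n - 2)))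

/-! For a finite 2-group, both sides are equivalent to having at most one involution. A unique
involution z lies in every nontrivial subgroup, so in a faithful action a point moved by z has
trivial stabilizer, and that forces 2-closure (`AtMostOneInvolution.isTwoClosedGroup`). Conversely,
a noncentral involution (`mem_center`) or two central ones (`eq_of_mem_center`) allow a faithful
action on a union of coset spaces whose 2-closure is too large. For the classification, a normal
abelian self-centralizing subgroup is cyclic by counting roots of unity, and every element outside
it inverts it (`conj_eq_inv_of_notMem`). Hence its index is at most 2, which leaves the cyclic and
quaternion groups. -/

/-! ### Necessity: test actions on coset spaces -/

/-- In a 2-closed group, a permutation of a finite faithful `G`-set agreeing on every pair of points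
with an element of `G` is the action of an element of `G`. -/
theorem IsTwoClosedGroup.exists_smul_eq {G : Type u} [Group G] (hG : IsTwoClosedGroup.{u, w} G)
    {X : Type u} [Finite X] [MulAction G X] [FaithfulSMul G X] (θ : Equiv.Perm X)
    (hθ : ∀ α β : X, ∃ g : G, θ α = g • α ∧ θ β = g • β) : ∃ g : G, ∀ α, θ α = g • α := by
  obtain ⟨n, ⟨e'⟩⟩ := Finite.exists_equiv_fin X
  -- A finite set has a copy in every universe, so testing in `Type w` suffices.
  let e : X ≃ ULift.{w} (Fin n) := e'.trans Equiv.ulift.symm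
  let φ : G →* Equiv.Perm (ULift.{w} (Fin n)) :=
    e.permCongrHom.toMonoidHom.comp (MulAction.toPermHom G X)
  have hφ : Function.Injective φ :=
    e.permCongrHom.injective.comp MulAction.toPerm_injective
  have key := hG _ φ.range ⟨MonoidHom.ofInjective hφ⟩
  have hmem : e.permCongr θ ∈ φ.range := by
    rw [key]
    intro α β
    obtain ⟨g, h₁, h₂⟩ := hθ (e.symm α) (e.symm β)
    refine ⟨φ g, ⟨g, rfl⟩, ?_, ?_⟩
    · exact congrArg e h₁
    · exact congrArg e h₂
  obtain ⟨g, hg⟩ := hmem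
  refine ⟨g, fun α => ?_⟩
  have h := congrArg (fun σ : Equiv.Perm _ => e.symm (σ (e α))) hg
  simpa [φ] using h.symm

theorem mem_zpowers_iff_of_mul_self_eq_one {G : Type*} [Group G] {t g : G} (ht : t * t = 1) :
    g ∈ Subgroup.zpowers t ↔ g = 1 ∨ g = t := by
  constructor
  · rintro ⟨k, rfl⟩
    have h2 : t ^ (2 : ℤ) = 1 := by rw [zpow_two, ht]
    rcases Int.even_or_odd' k with ⟨c, rfl | rfl⟩
    · left; simp [zpow_mul, h2]
    · right; simp [zpow_add, zpow_mul, h2]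
  · rintro (rfl | rfl)
    · exact one_mem _
    · exact Subgroup.mem_zpowers _

/-- In a nilpotent group, a nontrivial element `t` is not in the subgroup `[⟨t⟩ᴳ, G]`. -/
theorem notMem_commutator_normalClosure {G : Type*} [Group G] [Group.IsNilpotent G] {t : G}
    (ht : t ≠ 1) : t ∉ ⁅Subgroup.normalClosure {t}, (⊤ : Subgroup G)⁆ := by
  intro h
  have hle : Subgroup.normalClosure {t} ≤ ⁅Subgroup.normalClosure {t}, (⊤ : Subgroup G)⁆ :=
    Subgroup.normalClosure_le_normal (by simpa using h)
  obtain ⟨n, hn⟩ := Subgroup.nilpotent_iff_lowerCentralSeries.mp ‹Group.IsNilpotent G›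
  have hlcs : ∀ n, Subgroup.normalClosure {t} ≤ (⊤ : Subgroup G).lowerCentralSeries n := by
    intro n
    induction n with
    | zero => exact le_top
    | succ n ih =>
      rw [Subgroup.lowerCentralSeries_succ]
      exact hle.trans (Subgroup.commutator_mono ih le_rfl)
  have := hlcs n (Subgroup.subset_normalClosure (Set.mem_singleton t))
  rw [hn] at this
  exact ht (by simpa using this)

/-- Involutions of a finite nilpotent 2-closed group are central. -/
theorem IsTwoClosedGroup.mem_center {G : Type u} [Group G] [Finite G] [Group.IsNilpotent G]
    (hG : IsTwoClosedGroup.{u, w} G) {t : G} (ht : t * t = 1) : t ∈ Subgroup.center G := by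
  by_contra hc
  have ht1 : t ≠ 1 := by rintro rfl; exact hc (one_mem _)
  let T := Subgroup.zpowers t
  let N := ⁅Subgroup.normalClosure {t}, (⊤ : Subgroup G)⁆
  have htN : t ∉ N := notMem_commutator_normalClosure ht1
  have hconj : ∀ g : G, g * t * g⁻¹ * t⁻¹ ∈ N := by
    intro g
    have h := Subgroup.commutator_mem_commutator
      (Subgroup.subset_normalClosure (Set.mem_singleton t)) (Subgroup.mem_top g)
    have h' := inv_mem h
    rwa [commutatorElement_inv, commutatorElement_def] at h'
  -- The kernel on G/T is the core of T, trivial because t is not central.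
  have hfix : ∀ g : G, (∀ q : G ⧸ T, g • q = q) → g = 1 := by
    intro g hg
    have h1 := hg ((1 : G) : G ⧸ T)
    rw [MulAction.Quotient.smul_coe, eq_comm, QuotientGroup.eq] at h1
    rcases (mem_zpowers_iff_of_mul_self_eq_one ht).mp h1 with h1 | h1
    · simpa using h1
    · have hgt : g = t := by simpa using h1
      subst hgt
      refine absurd (Subgroup.mem_center_iff.mpr fun y => ?_) hc
      have hy := hg (y : G ⧸ T)
      rw [MulAction.Quotient.smul_coe, eq_comm, QuotientGroup.eq] at hy
      rcases (mem_zpowers_iff_of_mul_self_eq_one ht).mp hy with hy | hy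
      · exfalso
        rw [inv_mul_eq_one] at hy
        exact ht1 (by simpa using hy)
      · rw [inv_mul_eq_iff_eq_mul] at hy
        exact hy.symm
  have : FaithfulSMul G ((G ⧸ T) ⊕ (G ⧸ N)) := by
    refine ⟨fun {g h} hgh => ?_⟩
    have : h⁻¹ * g = 1 := hfix _ fun q => by
      have : g • q = h • q := Sum.inl_injective (hgh (Sum.inl q))
      rw [mul_smul, this, inv_smul_smul]
    rw [inv_mul_eq_one] at this
    exact this.symm
  have hstab : ∀ (q : G ⧸ T) (r : G ⧸ N), ∃ g : G, g • q = q ∧ g • r = t • r := by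
    intro q r
    induction q using QuotientGroup.induction_on with | _ y
    induction r using QuotientGroup.induction_on with | _ s
    -- This conjugate fixes yT and acts on G/N as t does, since t is central modulo N.
    refine ⟨y * t * y⁻¹, ?_, ?_⟩
    · rw [MulAction.Quotient.smul_coe, eq_comm, QuotientGroup.eq]
      rw [smul_eq_mul, show y⁻¹ * (y * t * y⁻¹ * y) = t by group]
      exact Subgroup.mem_zpowers t
    · rw [MulAction.Quotient.smul_coe, MulAction.Quotient.smul_coe, eq_comm, QuotientGroup.eq]
      have h := (inferInstance : N.Normal).conj_mem _ (hconj y) (s⁻¹ * t⁻¹)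
      simpa [mul_assoc] using h
  obtain ⟨g, hg⟩ := hG.exists_smul_eq
    (Equiv.sumCongr (Equiv.refl (G ⧸ T)) (MulAction.toPerm t : Equiv.Perm (G ⧸ N))) (by
      rintro (q | r) (q' | r')
      · exact ⟨1, by simp⟩
      · obtain ⟨g, h₁, h₂⟩ := hstab q r'
        exact ⟨g, by simp [h₁], by simp [h₂]⟩
      · obtain ⟨g, h₁, h₂⟩ := hstab q' r
        exact ⟨g, by simp [h₂], by simp [h₁]⟩
      · exact ⟨t, by simp⟩)
  have hg1 : g = 1 := hfix g fun q => by simpa using (hg (Sum.inl q)).symm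
  have h := hg (Sum.inr ((1 : G) : G ⧸ N))
  rw [hg1, one_smul] at h
  have hfixed : t • ((1 : G) : G ⧸ N) = ((1 : G) : G ⧸ N) := Sum.inr_injective h
  rw [MulAction.Quotient.smul_coe, eq_comm, QuotientGroup.eq] at hfixed
  exact htN (by simpa using hfixed)

/-- A finite 2-closed group does not have two distinct central involutions. -/
theorem IsTwoClosedGroup.eq_of_mem_center {G : Type u} [Group G] [Finite G]
    (hG : IsTwoClosedGroup.{u, w} G) {s t : G} (hs : s ∈ Subgroup.center G)
    (ht : t ∈ Subgroup.center G) (hs2 : s * s = 1) (ht2 : t * t = 1) (hs1 : s ≠ 1) (ht1 : t ≠ 1) :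
    s = t := by
  by_contra hne
  have hst2 : (s * t) * (s * t) = 1 := by
    rw [mul_assoc, ← mul_assoc t s t, Subgroup.mem_center_iff.mp hs t, mul_assoc s t t, ht2,
      mul_one, hs2]
  have hfix : ∀ (H : Subgroup G) (c : G), c ∈ Subgroup.center G → c ∈ H →
      ∀ q : G ⧸ H, c • q = q := by
    intro H c hc hcH q
    induction q using QuotientGroup.induction_on with | _ y
    rw [MulAction.Quotient.smul_coe, eq_comm, QuotientGroup.eq, smul_eq_mul,
      ← Subgroup.mem_center_iff.mp hc y, inv_mul_cancel_left]
    exact hcH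
  have hmem : ∀ (H : Subgroup G) (g : G), g • ((1 : G) : G ⧸ H) = ((1 : G) : G ⧸ H) → g ∈ H := by
    intro H g h
    rw [MulAction.Quotient.smul_coe, eq_comm, QuotientGroup.eq] at h
    simpa using h
  have htriv : ∀ g : G, g ∈ Subgroup.zpowers t → g ∈ Subgroup.zpowers (s * t) → g = 1 := by
    intro g h₁ h₂
    rw [mem_zpowers_iff_of_mul_self_eq_one ht2] at h₁
    rw [mem_zpowers_iff_of_mul_self_eq_one hst2] at h₂
    rcases h₁ with h₁ | h₁
    · exact h₁
    · rcases h₂ with h₂ | h₂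
      · exact h₂
      · exact absurd (by simpa using h₁.symm.trans h₂) hs1
  have : FaithfulSMul G
      ((G ⧸ Subgroup.zpowers s) ⊕ (G ⧸ Subgroup.zpowers t) ⊕ (G ⧸ Subgroup.zpowers (s * t))) := by
    refine ⟨fun {g h} hgh => ?_⟩
    have : h⁻¹ * g = 1 := by
      refine htriv _ (hmem _ _ ?_) (hmem _ _ ?_)
      · have : g • ((1 : G) : G ⧸ Subgroup.zpowers t) = h • ((1 : G) : G ⧸ Subgroup.zpowers t) :=
          Sum.inl_injective
            (Sum.inr_injective (hgh (Sum.inr (Sum.inl ((1 : G) : G ⧸ Subgroup.zpowers t)))))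
        rw [mul_smul, this, inv_smul_smul]
      · have : g • ((1 : G) : G ⧸ Subgroup.zpowers (s * t)) = h • ((1 : G) : G ⧸ Subgroup.zpowers (s * t)) :=
          Sum.inr_injective
            (Sum.inr_injective (hgh (Sum.inr (Sum.inr ((1 : G) : G ⧸ Subgroup.zpowers (s * t))))))
        rw [mul_smul, this, inv_smul_smul]
    rw [inv_mul_eq_one] at this
    exact this.symm
  have hfs := hfix _ s hs (Subgroup.mem_zpowers s)
  have hft := hfix _ t ht (Subgroup.mem_zpowers t)
  have hfst := hfix _ (s * t) (mul_mem hs ht) (Subgroup.mem_zpowers (s * t))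
  have hst : ∀ q : G ⧸ Subgroup.zpowers s, (s * t) • q = t • q := by
    intro q
    rw [mul_smul, hfs]
  -- The test permutation is t on G/⟨s⟩ and trivial elsewhere. On G/⟨s⟩ it agrees with both t and
  -- st, of which t is trivial on G/⟨t⟩ and st on G/⟨st⟩.
  obtain ⟨g, hg⟩ := hG.exists_smul_eq
      (X := (G ⧸ Subgroup.zpowers s) ⊕ (G ⧸ Subgroup.zpowers t) ⊕ (G ⧸ Subgroup.zpowers (s * t)))
    (Equiv.sumCongr (MulAction.toPerm t) (Equiv.refl _)) (by
      rintro (q | r | r) (q' | r' | r')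
      · exact ⟨t, by simp⟩
      · exact ⟨t, by simp, by simp [hft]⟩
      · exact ⟨s * t, by simp [hst], by simp [hfst]⟩
      · exact ⟨t, by simp [hft], by simp⟩
      · exact ⟨1, by simp⟩
      · exact ⟨1, by simp⟩
      · exact ⟨s * t, by simp [hfst], by simp [hst]⟩
      · exact ⟨1, by simp⟩
      · exact ⟨1, by simp⟩)
  have hg1 : g = 1 := by
    refine htriv g (hmem _ _ ?_) (hmem _ _ ?_)
    · simpa using (hg (Sum.inr (Sum.inl ((1 : G) : G ⧸ _)))).symm
    · simpa using (hg (Sum.inr (Sum.inr ((1 : G) : G ⧸ _)))).symm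
  have h := hg (Sum.inl ((1 : G) : G ⧸ Subgroup.zpowers s))
  rw [hg1, one_smul] at h
  rcases (mem_zpowers_iff_of_mul_self_eq_one hs2).mp (hmem _ t (Sum.inl_injective h)) with h | h
  · exact ht1 h
  · exact hne h.symm

/-! ### Sufficiency: a unique involution gives a regular orbit -/

/-- The group `G` has at most one element of order two. -/
def AtMostOneInvolution (G : Type*) [Group G] : Prop :=
  ∀ s t : G, s * s = 1 → t * t = 1 → s ≠ 1 → t ≠ 1 → s = t

theorem IsTwoClosedGroup.atMostOneInvolution {G : Type u} [Group G] [Finite G]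
    [Group.IsNilpotent G] (hG : IsTwoClosedGroup.{u, w} G) : AtMostOneInvolution G :=
  fun _ _ hs ht hs1 ht1 =>
    hG.eq_of_mem_center (hG.mem_center hs) (hG.mem_center ht) hs ht hs1 ht1

theorem IsPGroup.exists_involution_mem {G : Type*} [Group G] (hG : IsPGroup 2 G) {g : G}
    (hg : g ≠ 1) : ∃ s ∈ Subgroup.zpowers g, s * s = 1 ∧ s ≠ 1 := by
  obtain ⟨k, hk⟩ := IsPGroup.iff_orderOf.mp hG g
  have hk0 : k ≠ 0 := by
    rintro rfl
    exact hg (orderOf_eq_one_iff.mp (by simpa using hk))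
  obtain ⟨k, rfl⟩ := Nat.exists_eq_succ_of_ne_zero hk0
  refine ⟨g ^ 2 ^ k, pow_mem (Subgroup.mem_zpowers g) _, ?_, ?_⟩
  · rw [← pow_add, ← two_mul, ← pow_succ', ← Nat.succ_eq_add_one, ← hk, pow_orderOf_eq_one]
  · refine pow_ne_one_of_lt_orderOf (by positivity) ?_
    rw [hk]
    exact Nat.pow_lt_pow_right one_lt_two (Nat.lt_succ_self k)

theorem AtMostOneInvolution.mem_zpowers {G : Type*} [Group G] (h : AtMostOneInvolution G)
    (hG : IsPGroup 2 G) {s g : G} (hs : s * s = 1) (hg : g ≠ 1) : s ∈ Subgroup.zpowers g := by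
  by_cases hs1 : s = 1
  · exact hs1 ▸ one_mem _
  · obtain ⟨t, ht, ht2, ht1⟩ := hG.exists_involution_mem hg
    exact h t s ht2 hs ht1 hs1 ▸ ht

/-- A permutation group with a point having trivial stabilizer equals its 2-closure. -/
theorem eq_twoClosure_of_stabilizer_eq_bot {Ω : Type*} {H : Subgroup (Equiv.Perm Ω)} (α : Ω)
    (hα : ∀ g ∈ H, g α = α → g = 1) : H = twoClosure H := by
  refine le_antisymm (fun g hg _ _ => ⟨g, hg, rfl, rfl⟩) fun θ hθ => ?_
  obtain ⟨g, hg, h₁, -⟩ := hθ α α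
  suffices θ = g from this ▸ hg
  ext β
  obtain ⟨k, hk, k₁, k₂⟩ := hθ α β
  have hkg : g⁻¹ * k = 1 := hα _ (mul_mem (inv_mem hg) hk) (by
    rw [Equiv.Perm.mul_apply, ← k₁, h₁]
    exact g.symm_apply_apply α)
  rw [k₂, ← inv_mul_eq_one.mp hkg]

theorem AtMostOneInvolution.isTwoClosedGroup {G : Type u} [Group G] (h : AtMostOneInvolution G)
    (hG : IsPGroup 2 G) : IsTwoClosedGroup.{u, w} G := by
  rintro Ω H ⟨f⟩
  rcases subsingleton_or_nontrivial G with hs | hn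
  · have hH : ∀ g ∈ H, g = 1 := by
      intro g hg
      have : (⟨g, hg⟩ : H) = 1 := by
        rw [← f.apply_symm_apply ⟨g, hg⟩, Subsingleton.elim (f.symm _) 1, map_one]
      exact congrArg Subtype.val this
    refine le_antisymm (fun g hg _ _ => ⟨g, hg, rfl, rfl⟩) fun θ hθ => ?_
    suffices θ = 1 from this ▸ one_mem H
    ext β
    obtain ⟨g, hg, h₁, -⟩ := hθ β β
    rw [h₁, hH g hg]
  · obtain ⟨g₀, hg₀⟩ := exists_ne (1 : G)
    obtain ⟨z, -, hz2, hz1⟩ := hG.exists_involution_mem hg₀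
    have hfz : (f z : Equiv.Perm Ω) ≠ 1 := by
      intro hf
      exact hz1 (f.injective (Subtype.ext (by simpa using hf)))
    obtain ⟨α, hα⟩ : ∃ α, (f z : Equiv.Perm Ω) α ≠ α := by
      by_contra! hcon
      exact hfz (Equiv.ext hcon)
    refine eq_twoClosure_of_stabilizer_eq_bot α fun g hg hgα => ?_
    by_contra hg1
    have hne : f.symm ⟨g, hg⟩ ≠ 1 := by
      intro h1
      rw [MulEquiv.symm_apply_eq, map_one] at h1
      exact hg1 (congrArg Subtype.val h1)
    obtain ⟨k, hk⟩ := h.mem_zpowers hG hz2 hne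
    apply hα
    have hk' : f z = (⟨g, hg⟩ : H) ^ k := by
      rw [← hk]
      simp
    rw [hk']
    exact zpow_mem (K := MulAction.stabilizer (Equiv.Perm Ω) α) hgα k

/-! ### Cyclic and quaternion groups have at most one involution -/

open scoped commutatorElement

theorem AtMostOneInvolution.of_injective {G H : Type*} [Group G] [Group H]
    (hH : AtMostOneInvolution H) (f : G →* H) (hf : Function.Injective f) :
    AtMostOneInvolution G := by
  intro s t hs ht hs1 ht1
  refine hf (hH _ _ ?_ ?_ ?_ ?_)
  · rw [← map_mul, hs, map_one]
  · rw [← map_mul, ht, map_one]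
  · rwa [Ne, map_eq_one_iff f hf]
  · rwa [Ne, map_eq_one_iff f hf]

theorem atMostOneInvolution_of_isCyclic (G : Type*) [Group G] [Finite G] [IsCyclic G] :
    AtMostOneInvolution G := by
  classical
  have := Fintype.ofFinite G
  intro s t hs ht hs1 ht1
  by_contra hne
  have hsub : ({1, s, t} : Finset G) ⊆ Finset.univ.filter fun x : G => x ^ 2 = 1 := by
    intro x hx
    simp only [Finset.mem_insert, Finset.mem_singleton] at hx
    rcases hx with rfl | rfl | rfl <;> simp [sq, *]
  have h := (Finset.card_le_card hsub).trans (IsCyclic.card_pow_eq_one_le two_pos)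
  rw [Finset.card_eq_three.mpr ⟨1, s, t, hs1.symm, ht1.symm, hne, rfl⟩] at h
  omega

/-- The elements `xa i` have order 4, and 2i = 0 modulo 2n leaves only i = 0 and i = n. -/
theorem atMostOneInvolution_quaternionGroup (n : ℕ) [NeZero n] :
    AtMostOneInvolution (QuaternionGroup n) := by
  have key : ∀ s : QuaternionGroup n, s * s = 1 → s ≠ 1 →
      s = QuaternionGroup.a (n : ZMod (2 * n)) := by
    rintro (i | i) hs hs1
    · rw [QuaternionGroup.a_mul_a, QuaternionGroup.one_def, QuaternionGroup.a.injEq] at hs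
      rw [QuaternionGroup.one_def, Ne, QuaternionGroup.a.injEq] at hs1
      congr 1
      have : NeZero (2 * n) := ⟨by simp [NeZero.ne n]⟩
      have hv : (((i.val + i.val : ℕ)) : ZMod (2 * n)) = 0 := by
        rw [Nat.cast_add, ZMod.natCast_zmod_val, hs]
      rw [ZMod.natCast_eq_zero_iff] at hv
      obtain ⟨c, hc⟩ := hv
      have hlt := ZMod.val_lt i
      have hne : i.val ≠ 0 := by rwa [Ne, ZMod.val_eq_zero]
      have hn0 := NeZero.pos n
      have hic : i.val = n * c := by rw [mul_assoc] at hc; omega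
      have hc1 : c = 1 := by
        rcases c with _ | _ | c
        · simp at hic; exact absurd hic (by simpa using hne)
        · rfl
        · nlinarith
      rw [hc1, mul_one] at hic
      rw [← ZMod.natCast_zmod_val i, hic]
    · exfalso
      have h4 := QuaternionGroup.orderOf_xa i
      have := orderOf_le_of_pow_eq_one two_pos ((sq _).trans hs)
      omega
  intro s t hs ht hs1 ht1
  rw [key s hs hs1, key t ht ht1]

/-! ### Classification of 2-groups with at most one involution -/

/-- A finite abelian 2-group with at most one involution is cyclic. -/
theorem AtMostOneInvolution.isCyclic {A : Type*} [Group A] [Finite A] (h : AtMostOneInvolution A)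
    (hA : IsPGroup 2 A) (hcomm : ∀ x y : A, x * y = y * x) : IsCyclic A := by
  classical
  have := Fintype.ofFinite A
  have hpow : ∀ k : ℕ, Finset.card {x : A | x ^ 2 ^ k = 1} ≤ 2 ^ k := by
    intro k
    induction k with
    | zero => exact Finset.card_le_one.mpr (by simp)
    | succ k ih =>
      -- Squaring has fibres of size at most 2, since quotients within a fibre square to 1.
      have := Finset.card_le_mul_card_image_of_maps_to (f := fun x : A => x ^ 2)
        (s := {x : A | x ^ 2 ^ (k + 1) = 1}) (t := {x : A | x ^ 2 ^ k = 1}) (by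
          intro x hx
          simp only [Finset.mem_filter_univ] at hx ⊢
          rw [← pow_mul, ← pow_succ', hx]) 2 (by
          intro b _
          by_contra! hcard
          obtain ⟨x, y, z, hx, hy, hz, hxy, hxz, hyz⟩ := Finset.two_lt_card_iff.mp hcard
          simp only [Finset.mem_filter] at hx hy hz
          have hsq : ∀ {u v : A}, u ^ 2 = b → v ^ 2 = b → (u⁻¹ * v) * (u⁻¹ * v) = 1 := by
            intro u v hu hv
            rw [← sq, Commute.mul_pow (hcomm _ _), inv_pow, hu, hv, inv_mul_cancel]
          have hne : ∀ {u v : A}, u ≠ v → u⁻¹ * v ≠ 1 := fun huv h1 =>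
            huv (inv_mul_eq_one.mp h1)
          exact hyz (mul_left_cancel
            (h _ _ (hsq hx.2 hy.2) (hsq hx.2 hz.2) (hne hxy) (hne hxz))))
      calc _ ≤ _ := this
        _ ≤ 2 * 2 ^ k := Nat.mul_le_mul_left 2 ih
        _ = 2 ^ (k + 1) := by rw [pow_succ']
  obtain ⟨m, hm⟩ := IsPGroup.iff_card.mp hA
  refine isCyclic_of_card_pow_eq_one_le fun n hn => ?_
  obtain ⟨j, -, hj⟩ := (Nat.dvd_prime_pow Nat.prime_two).mp (Nat.gcd_dvd_right n (2 ^ m))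
  have hsub : (Finset.univ.filter fun x : A => x ^ n = 1) ⊆
      Finset.univ.filter fun x : A => x ^ 2 ^ j = 1 := by
    intro x hx
    simp only [Finset.mem_filter_univ] at hx ⊢
    rw [← hj, ← orderOf_dvd_iff_pow_eq_one]
    exact Nat.dvd_gcd (orderOf_dvd_of_pow_eq_one hx) (hm ▸ orderOf_dvd_natCard x)
  calc _ ≤ _ := Finset.card_le_card hsub
    _ ≤ 2 ^ j := hpow j
    _ ≤ n := hj ▸ Nat.le_of_dvd hn (Nat.gcd_dvd_left n (2 ^ m))

/-- A finite nilpotent group has a normal abelian subgroup containing its own centralizer. -/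
theorem exists_normal_abelian_centralizer_le (G : Type*) [Group G] [Finite G]
    [Group.IsNilpotent G] : ∃ A : Subgroup G, A.Normal ∧ (∀ x ∈ A, ∀ y ∈ A, x * y = y * x) ∧
      ∀ c : G, (∀ x ∈ A, c * x = x * c) → c ∈ A := by
  let S : Set (Subgroup G) := {A | A.Normal ∧ ∀ x ∈ A, ∀ y ∈ A, x * y = y * x}
  obtain ⟨A, hA⟩ := S.toFinite.exists_maximal
    ⟨⊥, inferInstance, by simp⟩
  obtain ⟨hnormal, hcomm⟩ := hA.prop
  refine ⟨A, hnormal, hcomm, ?_⟩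
  by_contra! hcon
  obtain ⟨c₀, hc₀, hc₀A⟩ := hcon
  obtain ⟨n₀, hn₀⟩ := Group.IsNilpotent.nilpotent G
  -- Taking c as low as possible in the upper central series puts each [c, y] in A. So c is central
  -- modulo A, and A⟨c⟩ is a larger normal abelian subgroup.
  have hex : ∃ n : ℕ, ∃ c ∈ Subgroup.upperCentralSeries G n,
      (∀ x ∈ A, c * x = x * c) ∧ c ∉ A := ⟨n₀, c₀, hn₀ ▸ Subgroup.mem_top _, hc₀, hc₀A⟩
  classical
  obtain ⟨c, hcn, hcA, hc⟩ := Nat.find_spec hex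
  have hmin : ∀ m < Nat.find hex, ∀ d ∈ Subgroup.upperCentralSeries G m,
      (∀ x ∈ A, d * x = x * d) → d ∈ A := by
    intro m hm d hd hdA
    by_contra hd'
    exact Nat.find_min hex hm ⟨d, hd, hdA, hd'⟩
  obtain ⟨m, hm⟩ : ∃ m, Nat.find hex = m + 1 := by
    refine Nat.exists_eq_succ_of_ne_zero fun h0 => ?_
    rw [h0, Subgroup.upperCentralSeries_zero, Subgroup.mem_bot] at hcn
    exact hc (hcn ▸ one_mem A)
  rw [hm, Subgroup.mem_upperCentralSeries_succ_iff] at hcn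
  have hcent : ∀ y : G, ⁅c, y⁆ ∈ A := by
    intro y
    refine hmin m (by omega) _ (hcn y) ?_
    change ∀ x ∈ A, Commute _ x
    intro x hx
    have h1 : ∀ z ∈ A, Commute c z := hcA
    have h2 : Commute (y * c⁻¹ * y⁻¹) x := by
      have h3 := h1 _ (hnormal.conj_mem x hx y⁻¹)
      have h4 := (Commute.conj_iff y).mpr h3.inv_left
      simpa [mul_assoc] using h4
    have h5 := (h1 x hx).mul_left h2
    rw [commutatorElement_def]
    simpa [mul_assoc] using h5
  let Z := Subgroup.zpowers (c : G ⧸ A)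
  have hZ : Z.Normal := by
    suffices h : Z ≤ Subgroup.center (G ⧸ A) from
      ⟨fun n hn g => by rwa [Subgroup.mem_center_iff.mp (h hn), mul_inv_cancel_right]⟩
    rw [Subgroup.zpowers_le, Subgroup.mem_center_iff]
    intro q
    induction q using QuotientGroup.induction_on with | _ y
    rw [← QuotientGroup.mk_mul, ← QuotientGroup.mk_mul, eq_comm, ← mul_inv_eq_one,
      ← QuotientGroup.mk_inv, ← QuotientGroup.mk_mul, QuotientGroup.eq_one_iff]
    simpa [commutatorElement_def, mul_assoc] using hcent y
  have hB : Z.comap (QuotientGroup.mk' A) ∈ S := by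
    refine ⟨hZ.comap _, ?_⟩
    have hdec : ∀ x ∈ Z.comap (QuotientGroup.mk' A), ∃ k : ℤ, ∃ a ∈ A, x = c ^ k * a := by
      rintro x ⟨k, hk⟩
      refine ⟨k, c ^ (-k) * x, ?_, by simp⟩
      rw [← QuotientGroup.eq_one_iff, QuotientGroup.mk_mul, QuotientGroup.mk_zpow]
      have hk' : (c : G ⧸ A) ^ k = (x : G ⧸ A) := hk
      rw [← hk', zpow_neg, inv_mul_cancel]
    intro x hx y hy
    obtain ⟨k, a, ha, rfl⟩ := hdec x hx
    obtain ⟨l, b, hb, rfl⟩ := hdec y hy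
    have hca : Commute c a := hcA a ha
    have hcb : Commute c b := hcA b hb
    have hab : Commute a b := hcomm a ha b hb
    exact (((Commute.refl c).zpow_zpow k l).mul_right (hcb.zpow_left k)).mul_left
      ((hca.symm.zpow_right l).mul_right hab)
  have hAB : A ≤ Z.comap (QuotientGroup.mk' A) := by
    intro x hx
    refine Subgroup.mem_comap.mpr ?_
    rw [QuotientGroup.mk'_apply, (QuotientGroup.eq_one_iff x).mpr hx]
    exact one_mem Z
  exact hc (hA.le_of_ge hB hAB (Subgroup.mem_comap.mpr (Subgroup.mem_zpowers _)))

theorem conj_zpow_eq {G : Type*} [Group G] {a x : G} {k : ℤ} (hk : x * a * x⁻¹ = a ^ k) (i : ℤ) :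
    x * a ^ i * x⁻¹ = a ^ (k * i) := by
  rw [← conj_zpow, hk, zpow_mul]

/-- In a 2-group with at most one involution, an element outside a normal self-centralizing cyclic
subgroup, with square inside, acts on it by inversion. -/
theorem AtMostOneInvolution.conj_eq_inv {G : Type*} [Group G]
    (hU : AtMostOneInvolution G) (hG : IsPGroup 2 G) {a : G} (hN : (Subgroup.zpowers a).Normal)
    (hC : ∀ c : G, c * a = a * c → c ∈ Subgroup.zpowers a) {x : G}
    (hx : x ∉ Subgroup.zpowers a) (hx2 : x ^ 2 ∈ Subgroup.zpowers a) : x * a * x⁻¹ = a⁻¹ := by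
  have ha1 : a ≠ 1 := by
    rintro rfl
    exact hx (hC x (by simp))
  obtain ⟨k, hk⟩ := hN.conj_mem a (Subgroup.mem_zpowers a) x
  obtain ⟨s, hs⟩ := hx2
  replace hk : x * a * x⁻¹ = a ^ k := hk.symm
  replace hs : a ^ s = x ^ 2 := hs
  have hsq : ∀ i : ℤ, (a ^ i * x) * (a ^ i * x) = a ^ (i + k * i + s) := by
    intro i
    rw [zpow_add, zpow_add, hs, ← conj_zpow_eq hk]
    group
  -- Elements squaring to 1 lie in ⟨a⟩, but aⁱx does not.
  have hno : ∀ i : ℤ, a ^ (i + k * i + s) ≠ 1 := by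
    intro i hi
    have h1 := hU.mem_zpowers hG ((hsq i).trans hi) ha1
    exact hx ((Subgroup.mul_mem_cancel_left _ (zpow_mem (Subgroup.mem_zpowers a) i)).mp h1)
  obtain ⟨m, hm⟩ := IsPGroup.iff_orderOf.mp hG a
  have hdvd : ∀ i : ℤ, a ^ i = 1 ↔ (2 : ℤ) ^ m ∣ i := by
    intro i
    rw [← orderOf_dvd_iff_zpow_eq_one, hm]
    push_cast
    rfl
  have hfix : (2 : ℤ) ^ m ∣ (k - 1) * s := by
    rw [← hdvd, sub_mul, one_mul, zpow_sub, ← conj_zpow_eq hk, hs]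
    group
  have hk1 : ¬ (2 : ℤ) ^ m ∣ k - 1 := by
    rw [← hdvd, zpow_sub, zpow_one, mul_inv_eq_one, ← hk, mul_inv_eq_iff_eq_mul]
    exact fun h => hx (hC x h)
  have hodd : ∀ j : ℤ, IsCoprime ((2 : ℤ) ^ m) (2 * j + 1) := fun j =>
    IsCoprime.pow_left ⟨-j, 1, by ring⟩
  -- An even k would kill the involution of ⟨a⟩; the remaining cases are k = 4l + 1 and k = 4l + 3.
  rcases Int.even_or_odd' k with ⟨j, rfl | rfl⟩
  · exfalso
    have hm0 : m ≠ 0 := by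
      rintro rfl
      exact hk1 (by simp)
    obtain ⟨r, rfl⟩ := Nat.exists_eq_succ_of_ne_zero hm0
    have h1 : a ^ (2 * j * 2 ^ r) = 1 := (hdvd _).mpr ⟨j, by rw [Nat.succ_eq_add_one]; ring⟩
    rw [← conj_zpow_eq hk, conj_eq_one_iff, hdvd] at h1
    have := Int.le_of_dvd (by positivity) h1
    rw [Nat.succ_eq_add_one, pow_succ] at this
    have h2 : (0 : ℤ) < 2 ^ r := by positivity
    omega
  rcases Int.even_or_odd' j with ⟨l, rfl | rfl⟩
  · exfalso
    rcases Int.even_or_odd' s with ⟨r, rfl | rfl⟩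
    · obtain ⟨u, v, huv⟩ := hodd l
      -- Here v inverts 2l + 1 modulo 2^m, so this i solves i(4l + 2) + 2r = 0.
      refine hno (-(r * v)) ((hdvd _).mpr ⟨2 * r * u, ?_⟩)
      linear_combination (-2 * r) * huv
    · exact hk1 ((hodd r).dvd_of_dvd_mul_right hfix)
  · have h2s : (2 : ℤ) ^ m ∣ 2 * s := by
      refine (hodd l).dvd_of_dvd_mul_left ?_
      rwa [show (2 * l + 1) * (2 * s) = (2 * (2 * l + 1) + 1 - 1) * s by ring]
    have hx4 : x ^ 2 * x ^ 2 = 1 := by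
      rw [← hs, ← zpow_add, hdvd]
      convert h2s using 1
      ring
    by_contra hne
    have hk2 : a ^ (1 + (2 * (2 * l + 1) + 1)) ≠ 1 := by
      rw [zpow_add, zpow_one, ← hk]
      exact fun h => hne (eq_inv_of_mul_eq_one_right h)
    -- If k ≠ -1 modulo 2^m, then x² is a power of a^(1+k), and the opposite exponent contradicts
    -- `hno`.
    obtain ⟨i, hi⟩ := hU.mem_zpowers hG hx4 hk2
    refine hno (-i) ?_
    rw [zpow_add, hs, ← hi]
    change _ * (a ^ (1 + (2 * (2 * l + 1) + 1))) ^ i = 1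
    rw [← zpow_mul, ← zpow_add, hdvd]
    exact ⟨0, by ring⟩

/-- In a 2-group with at most one involution, every element outside a normal self-centralizing
cyclic subgroup acts on it by inversion. -/
theorem AtMostOneInvolution.conj_eq_inv_of_notMem {G : Type*} [Group G]
    (hU : AtMostOneInvolution G) (hG : IsPGroup 2 G) {a : G} (hN : (Subgroup.zpowers a).Normal)
    (hC : ∀ c : G, c * a = a * c → c ∈ Subgroup.zpowers a) {x : G}
    (hx : x ∉ Subgroup.zpowers a) : x * a * x⁻¹ = a⁻¹ := by
  have hfour : ∀ y : G, y ^ 4 ∈ Subgroup.zpowers a → y ^ 2 ∈ Subgroup.zpowers a := by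
    intro y hy
    by_contra hy2
    have hinv := hU.conj_eq_inv hG hN hC hy2 (by rwa [← pow_mul])
    obtain ⟨l, hl⟩ := hN.conj_mem a (Subgroup.mem_zpowers a) y
    replace hl : y * a * y⁻¹ = a ^ l := hl.symm
    -- Since y² inverts a, -1 is a square modulo the order of a. That order is thus at most 2,
    -- inversion is trivial, and y² centralizes a.
    have hll : a ^ (l * l + 1) = 1 := by
      have h : a ^ (l * l) = a⁻¹ := by
        rw [← conj_zpow_eq hl, ← hl, ← hinv]
        simp [sq, mul_assoc]
      rw [zpow_add, zpow_one, h, inv_mul_cancel]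
    obtain ⟨m, hm⟩ := IsPGroup.iff_orderOf.mp hG a
    rw [← orderOf_dvd_iff_zpow_eq_one, hm] at hll
    have hm2 : m < 2 := by
      by_contra! hm2
      have h4 : (4 : ℤ) ∣ l * l + 1 := by
        refine dvd_trans ?_ hll
        exact_mod_cast (pow_dvd_pow 2 hm2 : 2 ^ 2 ∣ 2 ^ m)
      rcases Int.even_or_odd' l with ⟨j, rfl | rfl⟩ <;> ring_nf at h4 <;> omega
    have ha2 : a * a = 1 := by
      rw [← sq, ← orderOf_dvd_iff_pow_eq_one, hm]
      simpa using pow_dvd_pow 2 (Nat.le_of_lt_succ hm2)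
    rw [← eq_inv_of_mul_eq_one_left ha2, mul_inv_eq_iff_eq_mul] at hinv
    exact hy2 (hC _ hinv)
  have hpow : ∀ r : ℕ, x ^ 2 ^ (r + 1) ∈ Subgroup.zpowers a → x ^ 2 ∈ Subgroup.zpowers a := by
    intro r
    induction r with
    | zero => simp
    | succ r ih =>
      intro h
      refine ih ?_
      rw [pow_succ, pow_mul]
      refine hfour _ ?_
      rw [← pow_mul]
      convert h using 2
      ring
  obtain ⟨k, hk⟩ := hG.exists_pow_pow_eq_one x
  refine hU.conj_eq_inv hG hN hC hx (hpow k ?_)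
  rw [pow_succ, pow_mul, hk, one_pow]
  exact one_mem _

/-- A group generated by `a` of order `2 * n` and `x ∉ ⟨a⟩` inverting `a`, with `x ^ 2 = a ^ n` and
`⟨a⟩` of index at most two, is a quaternion group. -/
theorem nonempty_mulEquiv_quaternionGroup {G : Type*} [Group G] {n : ℕ} {a x : G}
    (ha : orderOf a = 2 * n) (hx : x ∉ Subgroup.zpowers a) (hx2 : x * x = a ^ n)
    (hinv : x * a * x⁻¹ = a⁻¹)
    (hgen : ∀ g : G, g ∉ Subgroup.zpowers a → x⁻¹ * g ∈ Subgroup.zpowers a) :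
    Nonempty (G ≃* QuaternionGroup n) := by
  let P : ZMod (2 * n) → G := fun i => a ^ (i.cast : ℤ)
  have hP : ∀ k : ℤ, P k = a ^ k := by
    intro k
    change a ^ ((k : ZMod (2 * n)).cast : ℤ) = a ^ k
    rw [zpow_eq_zpow_iff_modEq, ha, ← ZMod.intCast_eq_intCast_iff, ZMod.intCast_zmod_cast]
  have hadd : ∀ i j, P (i + j) = P i * P j := by
    intro i j
    obtain ⟨k, rfl⟩ := ZMod.intCast_surjective i
    obtain ⟨l, rfl⟩ := ZMod.intCast_surjective j
    rw [← Int.cast_add, hP, hP, hP, zpow_add]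
  have hsub : ∀ i j, P (j - i) = (P i)⁻¹ * P j := by
    intro i j
    rw [eq_inv_mul_iff_mul_eq, ← hadd, add_sub_cancel]
  have hPn : P n = x * x := by
    rw [hx2, ← zpow_natCast, ← hP, Int.cast_natCast]
  have hPx : ∀ i, P i * x = x * (P i)⁻¹ := by
    intro i
    obtain ⟨k, rfl⟩ := ZMod.intCast_surjective i
    rw [hP]
    have h := conj_zpow_eq (hinv.trans (zpow_neg_one a).symm) (-k)
    rw [neg_mul_neg, one_mul, zpow_neg, mul_inv_eq_iff_eq_mul] at h
    exact h.symm
  let f : QuaternionGroup n → G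
    | .a i => P i
    | .xa i => x * P i
  let φ : QuaternionGroup n →* G := MonoidHom.mk' f (by
    rintro (i | i) (j | j)
    · exact hadd i j
    · change x * P (j - i) = P i * (x * P j)
      rw [hsub, ← mul_assoc, ← mul_assoc, hPx]
    · change x * P (i + j) = x * P i * P j
      rw [hadd, mul_assoc]
    · change P (n + j - i) = x * P i * (x * P j)
      rw [add_sub_assoc, hadd, hsub, hPn, mul_assoc x (P i), ← mul_assoc (P i), hPx]
      simp only [mul_assoc])
  have hPmem : ∀ i, P i ∈ Subgroup.zpowers a := fun i => ⟨_, rfl⟩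
  have hinj : Function.Injective φ := by
    rw [injective_iff_map_eq_one]
    rintro (i | i) hi
    · change P i = 1 at hi
      obtain ⟨k, rfl⟩ := ZMod.intCast_surjective i
      rw [hP, ← orderOf_dvd_iff_zpow_eq_one, ha] at hi
      rw [(ZMod.intCast_zmod_eq_zero_iff_dvd k (2 * n)).mpr hi, QuaternionGroup.a_zero]
    · change x * P i = 1 at hi
      exact absurd (eq_inv_of_mul_eq_one_left hi ▸ inv_mem (hPmem i)) hx
  have hsurj : Function.Surjective φ := by
    intro g
    by_cases hg : g ∈ Subgroup.zpowers a
    · obtain ⟨k, rfl⟩ := hg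
      exact ⟨.a k, hP k⟩
    · obtain ⟨k, hk⟩ := hgen g hg
      refine ⟨.xa k, ?_⟩
      change x * P k = g
      rw [hP]
      exact eq_inv_mul_iff_mul_eq.mp hk
  exact ⟨(MulEquiv.ofBijective φ ⟨hinj, hsurj⟩).symm⟩

/-- A finite 2-group with at most one involution is cyclic or generalized quaternion. -/
theorem AtMostOneInvolution.isCyclic_or_isGeneralizedQuaternion {G : Type u} [Group G] [Finite G]
    (hU : AtMostOneInvolution G) (hG : IsPGroup 2 G) :
    IsCyclic G ∨ IsGeneralizedQuaternion G := by
  have := hG.isNilpotent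
  obtain ⟨A, hN, hcomm, hcent⟩ := exists_normal_abelian_centralizer_le G
  have hcyc : IsCyclic A :=
    (hU.of_injective A.subtype A.subtype_injective).isCyclic (hG.to_subgroup A)
      fun x y => Subtype.ext (hcomm x x.2 y y.2)
  obtain ⟨a, rfl⟩ := (Subgroup.isCyclic_iff_exists_zpowers_eq_top A).mp hcyc
  have hC : ∀ c : G, c * a = a * c → c ∈ Subgroup.zpowers a := by
    intro c hc
    refine hcent c ?_
    rintro _ ⟨k, rfl⟩
    exact (Commute.zpow_right hc k : Commute c (a ^ k))
  by_cases htop : ∀ x, x ∈ Subgroup.zpowers a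
  · exact Or.inl ⟨a, htop⟩
  right
  push Not at htop
  obtain ⟨x, hx⟩ := htop
  have hconj : ∀ {g : G}, g ∉ Subgroup.zpowers a → g * a * g⁻¹ = a⁻¹ := fun hg =>
    hU.conj_eq_inv_of_notMem hG hN hC hg
  have hgen : ∀ g : G, g ∉ Subgroup.zpowers a → x⁻¹ * g ∈ Subgroup.zpowers a := by
    intro g hg
    -- Both x and g invert a, so x⁻¹g centralizes it.
    refine hC _ ?_
    have h1 := hconj hx
    rw [← hconj hg] at h1
    have h2 : x⁻¹ * (x * a * x⁻¹) * g = x⁻¹ * (g * a * g⁻¹) * g := by rw [h1]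
    simpa [mul_assoc] using h2.symm
  have hx2mem : x * x ∈ Subgroup.zpowers a := by
    have := hgen x⁻¹ (by rwa [inv_mem_iff])
    rwa [← mul_inv_rev, inv_mem_iff] at this
  -- As an element of ⟨a⟩, x² is inverted by x; it also commutes with x.
  have hxinv : x * x = (x * x)⁻¹ := by
    obtain ⟨s, hs⟩ := hx2mem
    have h := conj_zpow_eq ((hconj hx).trans (zpow_neg_one a).symm) s
    rw [neg_one_mul, zpow_neg, show a ^ s = x * x from hs] at h
    rwa [← mul_assoc, mul_inv_cancel_right] at h
  have ha1 : a ≠ 1 := by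
    rintro rfl
    exact hx (hC x (by simp))
  have hx1 : x * x ≠ 1 := fun h => hx (hU.mem_zpowers hG h ha1)
  obtain ⟨m, hm⟩ := IsPGroup.iff_orderOf.mp hG a
  have hm2 : 2 ≤ m := by
    by_contra! hlt
    have ha2 : a * a = 1 := by
      rw [← sq, ← orderOf_dvd_iff_pow_eq_one, hm]
      simpa using pow_dvd_pow 2 (Nat.le_of_lt_succ hlt)
    have h := hconj hx
    rw [← eq_inv_of_mul_eq_one_left ha2, mul_inv_eq_iff_eq_mul] at h
    exact hx (hC _ h)
  obtain ⟨r, rfl⟩ := Nat.exists_eq_add_of_le hm2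
  have hord : orderOf a = 2 * 2 ^ (r + 1) := by
    rw [hm]
    ring
  refine ⟨r + 3, by omega, ?_⟩
  rw [show r + 3 - 2 = r + 1 by omega]
  refine nonempty_mulEquiv_quaternionGroup hord hx ?_ (hconj hx) hgen
  -- Both x² and a^(2^(r+1)) are involutions, hence equal.
  refine hU _ _ (mul_eq_one_iff_eq_inv.mpr hxinv) ?_ hx1 ?_
  · rw [← pow_add, ← two_mul, ← hord, pow_orderOf_eq_one]
  · refine pow_ne_one_of_lt_orderOf (by positivity) ?_
    rw [hord]
    have : 0 < 2 ^ (r + 1) := by positivity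
    omega

theorem mainTheorem4 (G : Type u) [Group G] [Finite G] (hG : IsPGroup 2 G) :
    IsTwoClosedGroup.{u, w} G ↔ IsCyclic G ∨ IsGeneralizedQuaternion G := by
  have := hG.isNilpotent
  constructor
  · intro h
    exact h.atMostOneInvolution.isCyclic_or_isGeneralizedQuaternion hG
  · rintro (h | ⟨n, -, ⟨e⟩⟩)
    · exact (atMostOneInvolution_of_isCyclic G).isTwoClosedGroup hG
    · exact ((atMostOneInvolution_quaternionGroup _).of_injective e.toMonoidHom
        e.injective).isTwoClosedGroup hG
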